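/- \textbf{Setting.} A network has $L\ge 2$ layers; layer $l\in\{1,\dots,L\}$ has $M_l=\zeta_l N^2\ge 1$ weights $W^l_1,\dots,W^l_{M_l}$, where $N>0$ and $\zeta_l>0$ (so $M_l$ is an integer). All the weights are independent and $W^l_i\sim\mathcal N(0,\sigma_w^2/v_l)$ with $v_l=\alpha_l N$, $\alpha_l>0$, $\sigma_w>0$. Magnitude-based pruning with sparsity $s\in(0,1)$ prunes exactly the weights with $|W^l_i|<t_s$, where $t_s$ is the $k_s$-th largest of all the numbers $|W^l_i|$ and $k_s=\lceil(1-s)\sum_l M_l\rceil$. The critical sparsity $s_{cr}$ is the smallest $s\in(0,1)$ for which all the weights of at least one layer are pruned. Let $Q_x$ be the quantile of order $x\in(0,1)$ of $|X|$, $X\sim\mathcal N(0,1)$, and for $\gamma>1$ and $\epsilon\in(0,2)$ put $$x_{\epsilon,\gamma}=\inf\Big\{y\in(0,1):\ \gamma\,Q_x>Q_{1-(1-x)^{\gamma^{2-\epsilon}}}\ \text{ for all } x\in(y,1)\Big\},\qquad \inf\emptyset=\infty .$$ \textbf{Proposition (magnitude-based pruning in the large depth limit).} Let $N>0$ be fixed,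 and let the relative sizes of the layers be bounded, $\zeta_l\le Z$ for all $l$. Suppose there is a layer $l_0$ with $\alpha_{l_0}>\alpha_l$ for all $l\ne l_0$, and let $\gamma=\min_{l\neq l_0}\alpha_{l_0}/\alpha_l$. Then $x_{\epsilon,\gamma}$ is finite for every $\epsilon\in(0,2)$, and $$\mathbb E[s_{cr}]\ \le\ \inf_{\epsilon\in(0,2)}\Big\{x_{\epsilon,\gamma}+\frac{\zeta_{l_0}N^2}{1+\gamma^{2-\epsilon}}\,(1-x_{\epsilon,\gamma})^{1+\gamma^{2-\epsilon}}\Big\}+\frac{\nu}{\sqrt{LN^2}},$$ where the constant $\nu>0$ depends only on $N$, $Z$ and an upper bound $G$ for $\gamma$; in particular it depends neither on the depth $L$ nor on $\epsilon$. -/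

import Mathlib

open MeasureTheory ProbabilityTheory

namespace MagnitudePruning

/-- The index set of all the weights of a network with `L` layers, the `l`-th layer having
`M l` weights. -/
abbrev WeightIndex {L : ℕ} (M : Fin L → ℕ) : Type := Σ l : Fin L, Fin (M l)

/-- The total number of weights `∑ l, M l`. -/
def totalWeights {L : ℕ} (M : Fin L → ℕ) : ℕ := ∑ l, M l

/-- The `k`-th order statistic, in decreasing order, of a finite family `w` (meaningful for
`1 ≤ k ≤ card ι`): the `k`-th largest value, counted with multiplicity, is the largest `t` such
that at least `k` members of the family are `≥ t`. -/
noncomputable def orderStat {ι : Type*} [Fintype ι] (w : ι → ℝ) (k : ℕ) : ℝ :=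
  sSup {t : ℝ | k ≤ (Finset.univ.filter fun i => t ≤ w i).card}

/-- The number `k_s = (1 - s) ∑ l, M l` of weights that are kept at sparsity `s`, rounded up to an
integer. -/
noncomputable def keptCount {L : ℕ} (M : Fin L → ℕ) (s : ℝ) : ℕ :=
  ⌈(1 - s) * (totalWeights M : ℝ)⌉₊

/-- The magnitude threshold `t_s`: the `k_s`-th order statistic of all the absolute weights. -/
noncomputable def threshold {L : ℕ} {M : Fin L → ℕ} (w : (l : Fin L) → Fin (M l) → ℝ)
    (s : ℝ) : ℝ :=
  orderStat (fun j : WeightIndex M => |w j.1 j.2|) (keptCount M s)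

/-- The mask of magnitude-based pruning at sparsity `s`. -/
noncomputable def mask {L : ℕ} {M : Fin L → ℕ} (w : (l : Fin L) → Fin (M l) → ℝ) (s : ℝ)
    (l : Fin L) (i : Fin (M l)) : ℕ :=
  open Classical in if threshold w s ≤ |w l i| then 1 else 0

/-- The set `A_l` of the pruned weights of layer `l`. -/
noncomputable def prunedSet {L : ℕ} {M : Fin L → ℕ} (w : (l : Fin L) → Fin (M l) → ℝ) (s : ℝ)
    (l : Fin L) : Finset (Fin (M l)) :=
  Finset.univ.filter fun i => mask w s l i = 0

/-- The critical sparsity: the smallest sparsity `s ∈ (0,1)` at which a layer is fully pruned. -/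
noncomputable def criticalSparsity {L : ℕ} {M : Fin L → ℕ}
    (w : (l : Fin L) → Fin (M l) → ℝ) : ℝ :=
  sInf {s : ℝ | s ∈ Set.Ioo (0 : ℝ) 1 ∧ ∃ l : Fin L, (prunedSet w s l).card = M l}

/-- The law of `|X|` for a standard Gaussian `X`. -/
noncomputable def foldedNormal : Measure ℝ := (gaussianReal 0 1).map fun x => |x|

/-- The quantile of order `x` of `|X|`, `X` standard Gaussian (meaningful for `x ∈ (0,1)`). -/
noncomputable def quantile (x : ℝ) : ℝ := sInf {t : ℝ | x ≤ cdf foldedNormal t}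

/-- The point `x_{ε,γ}`: an infimum in the extended reals, so that it is `⊤` if no `y` qualifies. -/
noncomputable def xPoint (ε γ : ℝ) : EReal :=
  sInf ((fun y : ℝ => (y : EReal)) '' {y : ℝ | y ∈ Set.Ioo (0 : ℝ) 1 ∧
    ∀ x ∈ Set.Ioo y 1, quantile (1 - (1 - x) ^ (γ ^ (2 - ε))) < γ * quantile x})

/-- The ratio `γ = min_{l ≠ l₀} α_{l₀} / α_l`. -/
noncomputable def gammaRatio {L : ℕ} (α : Fin L → ℝ) (l₀ : Fin L) : ℝ :=
  ⨅ l : {l : Fin L // l ≠ l₀}, α l₀ / α l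

end MagnitudePruning

/-! The term inside the infimum is at least a constant `δ > 0` depending only on `G`, since `M l₀ ≥
1` and `1 < γ ≤ G` (`half_rpow_div_le`). It therefore suffices that the expected critical sparsity
is at most `δ` plus an error vanishing with the depth.

Choose `t` so that a proportion `δ` of all weights is expected to have magnitude at most `t`. If
some layer lies wholly below `t`, the critical sparsity is at most the actual proportion
(`criticalSparsity_le_of_layer_le`), whose mean is `δ`. Layers are independent and of bounded size,
so the probability that no layer does so is at most `exp (-c L)` (`prod_one_sub_pow_le`), and `exp
(-c L) ≤ 1 / √(c L)`.

The quantile comparison serves only to show that `xPoint` is finite: Gaussian tails decay like `exp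
(-t ^ 2 / 2)`, so scaling `t` by `γ` beats any power `a < γ ^ 2` of the tail. -/

namespace MagnitudePruning

/-! ### Order statistics and pathwise bounds on the critical sparsity -/

/-- The `k`-th largest value exceeds `x` exactly when at least `k` members exceed `x`. -/
lemma lt_orderStat_iff {ι : Type*} [Fintype ι] (w : ι → ℝ) {k : ℕ} (hk : 1 ≤ k)
    (hk' : k ≤ Fintype.card ι) (x : ℝ) :
    x < orderStat w k ↔ k ≤ (Finset.univ.filter fun i => x < w i).card := by
  have hle : ∀ i, |w i| ≤ ∑ i, |w i| := fun i =>
    Finset.single_le_sum (f := fun i => |w i|) (fun _ _ => abs_nonneg _) (Finset.mem_univ i)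
  have hne : {t : ℝ | k ≤ (Finset.univ.filter fun i => t ≤ w i).card}.Nonempty := by
    refine ⟨-∑ i, |w i|, ?_⟩
    have : (Finset.univ.filter fun i => -∑ i, |w i| ≤ w i) = Finset.univ :=
      Finset.filter_true_of_mem fun i _ => by linarith [hle i, neg_abs_le (w i)]
    rw [Set.mem_ofPred_eq, this]
    exact hk'
  have hbdd : BddAbove {t : ℝ | k ≤ (Finset.univ.filter fun i => t ≤ w i).card} := by
    refine ⟨∑ i, |w i|, fun t ht => ?_⟩
    obtain ⟨i, hi⟩ := Finset.card_pos.1 (hk.trans ht)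
    exact ((Finset.mem_filter.1 hi).2.trans (le_abs_self _)).trans (hle i)
  constructor
  · intro hx
    obtain ⟨t, ht, hxt⟩ := exists_lt_of_lt_csSup hne hx
    exact ht.trans (Finset.card_le_card
      (Finset.monotone_filter_right _ fun i _ hi => hxt.trans_le hi))
  · intro hx
    -- The least value above `x` is itself an admissible `t`, which makes the inequality strict.
    obtain ⟨i, hi, hmin⟩ := Finset.exists_min_image (Finset.univ.filter fun i => x < w i) w
      (Finset.card_pos.1 (hk.trans hx))
    refine (Finset.mem_filter.1 hi).2.trans_le (le_csSup hbdd (hx.trans (Finset.card_le_card ?_)))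
    exact fun j hj => Finset.mem_filter.2 ⟨Finset.mem_univ _, hmin j hj⟩

variable {L : ℕ} {M : Fin L → ℕ}

/-- The number of weights whose magnitude exceeds that of the weight with index `p`. -/
noncomputable def exceedCount (w : (l : Fin L) → Fin (M l) → ℝ) (p : WeightIndex M) : ℕ :=
  (Finset.univ.filter fun j : WeightIndex M => |w p.1 p.2| < |w j.1 j.2|).card

lemma card_weightIndex (M : Fin L → ℕ) : Fintype.card (WeightIndex M) = totalWeights M := by
  simp [totalWeights]

lemma totalWeights_pos_of_mem (l : Fin L) (i : Fin (M l)) : 0 < totalWeights M := by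
  rw [← card_weightIndex]
  exact Fintype.card_pos_iff.2 ⟨⟨l, i⟩⟩

/-- A layer is pruned completely exactly when each of its weights is exceeded by enough others. -/
lemma card_prunedSet_eq_iff (w : (l : Fin L) → Fin (M l) → ℝ) {s : ℝ}
    (hs : s ∈ Set.Ioo (0 : ℝ) 1) (l : Fin L) :
    (prunedSet w s l).card = M l ↔ ∀ i, keptCount M s ≤ exceedCount w ⟨l, i⟩ := by
  have h1 : (prunedSet w s l).card = M l ↔ ∀ i, |w l i| < threshold w s := by
    have : (prunedSet w s l).card = M l ↔ (prunedSet w s l).card = Fintype.card (Fin (M l)) := by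
      simp
    rw [this, Finset.card_eq_iff_eq_univ, Finset.eq_univ_iff_forall]
    simp [prunedSet, mask]
  rw [h1]
  refine forall_congr' fun i => ?_
  have hm : (0 : ℝ) < totalWeights M := by exact_mod_cast totalWeights_pos_of_mem l i
  refine lt_orderStat_iff (fun j : WeightIndex M => |w j.1 j.2|)
    (Nat.ceil_pos.2 (mul_pos (by linarith [hs.2]) hm)) ?_ _
  rw [card_weightIndex]
  exact Nat.ceil_le.2 (mul_le_of_le_one_left hm.le (by linarith [hs.1]))

lemma criticalSparsity_eq (w : (l : Fin L) → Fin (M l) → ℝ) :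
    criticalSparsity w = sInf {s : ℝ | s ∈ Set.Ioo (0 : ℝ) 1 ∧
      ∃ l : Fin L, ∀ i, keptCount M s ≤ exceedCount w ⟨l, i⟩} := by
  unfold criticalSparsity
  congr 1
  ext s
  exact and_congr_right fun hs => exists_congr fun l => card_prunedSet_eq_iff w hs l

lemma criticalSparsity_nonneg (w : (l : Fin L) → Fin (M l) → ℝ) : 0 ≤ criticalSparsity w :=
  Real.sInf_nonneg fun _ hs => hs.1.1.le

lemma criticalSparsity_le_one (w : (l : Fin L) → Fin (M l) → ℝ) : criticalSparsity w ≤ 1 := by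
  unfold criticalSparsity
  rcases Set.eq_empty_or_nonempty
    {s : ℝ | s ∈ Set.Ioo (0 : ℝ) 1 ∧ ∃ l : Fin L, (prunedSet w s l).card = M l} with h | ⟨s, hs⟩
  · rw [h, Real.sInf_empty]
    exact zero_le_one
  · exact (csInf_le ⟨0, fun _ h => h.1.1.le⟩ hs).trans hs.1.2.le

/-- If no weight of layer `l` exceeds `t`, the critical sparsity is at most the proportion of
weights that do not exceed `t`. -/
lemma criticalSparsity_le_of_layer_le (w : (l : Fin L) → Fin (M l) → ℝ) (t : ℝ) (l : Fin L)
    (hM : 1 ≤ M l) (hl : ∀ i, |w l i| ≤ t) :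
    criticalSparsity w ≤
      ((Finset.univ.filter fun j : WeightIndex M => |w j.1 j.2| ≤ t).card : ℝ) /
        totalWeights M := by
  have hm : 0 < totalWeights M := totalWeights_pos_of_mem l ⟨0, hM⟩
  have hmR : (0 : ℝ) < totalWeights M := by exact_mod_cast hm
  set C := (Finset.univ.filter fun j : WeightIndex M => |w j.1 j.2| ≤ t).card with hC
  have hsum : C + (Finset.univ.filter fun j : WeightIndex M => t < |w j.1 j.2|).card
      = totalWeights M := by
    rw [← card_weightIndex, ← Finset.card_univ,
      ← Finset.card_filter_add_card_filter_not (s := (Finset.univ : Finset (WeightIndex M)))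
        (fun j : WeightIndex M => |w j.1 j.2| ≤ t)]
    simp only [not_le, hC]
  have hC0 : 0 < C := Finset.card_pos.2
    ⟨⟨l, ⟨0, hM⟩⟩, Finset.mem_filter.2 ⟨Finset.mem_univ _, hl _⟩⟩
  have hC0R : (0 : ℝ) < C := by exact_mod_cast hC0
  -- If `C` is less than the total, `C / totalWeights M` is an admissible sparsity that keeps
  -- exactly as many weights as exceed `t`; otherwise the bound is at least 1.
  rcases Nat.lt_or_ge C (totalWeights M) with hlt | hge
  · have hltR : (C : ℝ) < totalWeights M := by exact_mod_cast hlt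
    rw [criticalSparsity_eq]
    refine csInf_le ⟨0, fun _ h => h.1.1.le⟩
      ⟨⟨div_pos hC0R hmR, (div_lt_one hmR).2 hltR⟩, l, fun i => ?_⟩
    have hk : keptCount M ((C : ℝ) / totalWeights M) =
        (Finset.univ.filter fun j : WeightIndex M => t < |w j.1 j.2|).card := by
      have : (1 - (C : ℝ) / totalWeights M) * totalWeights M =
          ((Finset.univ.filter fun j : WeightIndex M => t < |w j.1 j.2|).card : ℕ) := by
        rw [sub_mul, div_mul_cancel₀ _ hmR.ne', one_mul, sub_eq_iff_eq_add', ← Nat.cast_add, hsum]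
      rw [keptCount, this, Nat.ceil_natCast]
    rw [hk]
    exact Finset.card_le_card (Finset.monotone_filter_right _ fun j _ hj => (hl i).trans_lt hj)
  · refine (criticalSparsity_le_one w).trans ?_
    rw [one_le_div hmR]
    exact_mod_cast hge

lemma measurable_exceedCount (p : WeightIndex M) :
    Measurable fun x : WeightIndex M → ℝ => exceedCount (fun l i => x ⟨l, i⟩) p := by
  simp only [exceedCount, Finset.card_filter]
  refine Finset.measurable_fun_sum _ fun j _ => Measurable.ite ?_ measurable_const measurable_const
  exact measurableSet_lt (measurable_pi_apply _).abs (measurable_pi_apply _).abs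

/-- The critical sparsity depends only on the comparisons between the magnitudes. -/
lemma measurable_criticalSparsity :
    Measurable fun x : WeightIndex M → ℝ => criticalSparsity fun l i => x ⟨l, i⟩ := by
  -- The counts live in a countable discrete space, where every function is measurable.
  have h : Measurable fun n : WeightIndex M → ℕ => sInf {s : ℝ | s ∈ Set.Ioo (0 : ℝ) 1 ∧
      ∃ l : Fin L, ∀ i, keptCount M s ≤ n ⟨l, i⟩} := measurable_of_countable _
  simp only [criticalSparsity_eq]
  exact h.comp (measurable_pi_lambda _ measurable_exceedCount)

/-! ### Probability that no layer is small -/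

/-- The layers of an independent family of weights are independent. -/
lemma measureReal_iInter_compl_layer {Ω : Type*} [MeasurableSpace Ω] {P : Measure Ω}
    [IsProbabilityMeasure P] {V : WeightIndex M → Ω → ℝ} (hV : ∀ j, Measurable (V j))
    (hind : iIndepFun V P) {B : Set ℝ} (hB : MeasurableSet B) :
    P.real (⋂ l, (⋂ i, V ⟨l, i⟩ ⁻¹' B)ᶜ) = ∏ l, (1 - ∏ i, P.real (V ⟨l, i⟩ ⁻¹' B)) := by
  have hmeas : ∀ l, MeasurableSet (⋂ i, V ⟨l, i⟩ ⁻¹' B) := fun l =>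
    MeasurableSet.iInter fun i => hV _ hB
  have hprod : ∀ S : Finset (Fin L), P (⋂ l ∈ S, ⋂ i, V ⟨l, i⟩ ⁻¹' B) =
      ∏ l ∈ S, ∏ i, P (V ⟨l, i⟩ ⁻¹' B) := by
    intro S
    have h := hind.measure_inter_preimage_eq_mul (S.sigma fun _ => Finset.univ)
      (sets := fun _ => B) fun _ _ => hB
    rw [Finset.prod_sigma] at h
    rw [← h]
    congr 1
    ext ω
    simp only [Set.mem_iInter, Finset.mem_sigma, Finset.mem_univ, and_true]
    exact ⟨fun h j hj => h j.1 hj j.2, fun h l hl i => h ⟨l, i⟩ hl⟩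
  have hlayer : ∀ l, P (⋂ i, V ⟨l, i⟩ ⁻¹' B) = ∏ i, P (V ⟨l, i⟩ ⁻¹' B) := fun l => by
    simpa using hprod {l}
  have hset : iIndepSet (fun l => ⋂ i, V ⟨l, i⟩ ⁻¹' B) P := by
    rw [iIndepSet_iff_meas_biInter hmeas]
    intro S
    rw [hprod, Finset.prod_congr rfl fun l _ => hlayer l]
  have hcompl := (iIndepSet_iff _ _).1 hset Finset.univ
    (f := fun l => (⋂ i, V ⟨l, i⟩ ⁻¹' B)ᶜ)
    fun l _ => (MeasurableSpace.measurableSet_generateFrom (Set.mem_singleton _)).compl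
  simp only [Finset.mem_univ, Set.iInter_true] at hcompl
  rw [Measure.real, hcompl, ENNReal.toReal_prod]
  refine Finset.prod_congr rfl fun l _ => ?_
  rw [← Measure.real, probReal_compl_eq_one_sub (hmeas l), Measure.real, hlayer,
    ENNReal.toReal_prod]
  rfl

/-- For nonnegative numbers `p l ≤ 1` with a large weighted sum, the product of the
`1 - p l ^ M l` is exponentially small in their number. -/
lemma prod_one_sub_pow_le {p : Fin L → ℝ} (hp0 : ∀ l, 0 ≤ p l) (hp1 : ∀ l, p l ≤ 1) {K : ℕ}
    (hM1 : ∀ l, 1 ≤ M l) (hMK : ∀ l, M l ≤ K + 1) {δ : ℝ} (hδ : 0 < δ)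
    (hsum : ∑ l, M l * p l = δ * totalWeights M) :
    ∏ l, (1 - p l ^ M l) ≤ Real.exp (-(L * (δ / (K + 1)) ^ (K + 1))) := by
  rcases Nat.eq_zero_or_pos L with rfl | hL
  · simp
  have hL' : (0 : ℝ) < L := by exact_mod_cast hL
  have hK : (0 : ℝ) < K + 1 := by positivity
  have hlow : L * (δ / (K + 1)) ≤ ∑ l, p l := by
    have h1 : ∑ l, M l * p l ≤ ∑ l, (K + 1) * p l := Finset.sum_le_sum fun l _ =>
      mul_le_mul_of_nonneg_right (by exact_mod_cast hMK l) (hp0 l)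
    have h2 : (L : ℝ) ≤ totalWeights M := by
      have : ∑ _l : Fin L, 1 ≤ ∑ l, M l := Finset.sum_le_sum fun l _ => hM1 l
      simpa [totalWeights] using (Nat.cast_le (α := ℝ)).2 this
    rw [← Finset.mul_sum, hsum] at h1
    rw [← mul_div_assoc, div_le_iff₀ hK]
    nlinarith
  -- Power mean inequality: the average of the `p l` is at least `δ / (K + 1)`.
  have hpow : L * (δ / (K + 1)) ^ (K + 1) ≤ ∑ l, p l ^ (K + 1) := by
    have h1 := pow_sum_div_card_le_sum_pow (s := Finset.univ) (f := p) (fun l _ => hp0 l) K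
    rw [Finset.card_univ, Fintype.card_fin] at h1
    refine le_trans ?_ h1
    rw [le_div_iff₀ (by positivity)]
    calc L * (δ / (K + 1)) ^ (K + 1) * (L : ℝ) ^ K = (L * (δ / (K + 1))) ^ (K + 1) := by ring
      _ ≤ (∑ l, p l) ^ (K + 1) := pow_le_pow_left₀ (by positivity) hlow _
  calc ∏ l, (1 - p l ^ M l) ≤ ∏ l, Real.exp (-p l ^ (K + 1)) :=
        Finset.prod_le_prod (fun l _ => sub_nonneg.2 (pow_le_one₀ (hp0 l) (hp1 l))) fun l _ => by
          have h1 := pow_le_pow_of_le_one (hp0 l) (hp1 l) (hMK l)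
          have h2 := Real.add_one_le_exp (-p l ^ (K + 1))
          linarith
    _ = Real.exp (-∑ l, p l ^ (K + 1)) := by rw [← Real.exp_sum, Finset.sum_neg_distrib]
    _ ≤ _ := Real.exp_le_exp.2 (neg_le_neg hpow)

/-! ### Law of the magnitudes and choice of `t` -/

/-- The law of the magnitude of a centred normal variable. -/
noncomputable def absGaussian (v : NNReal) : Measure ℝ := (gaussianReal 0 v).map fun x => |x|

instance (v : NNReal) : IsProbabilityMeasure (absGaussian v) :=
  Measure.isProbabilityMeasure_map (by fun_prop)

lemma cdf_absGaussian (v : NNReal) (t : ℝ) :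
    cdf (absGaussian v) t = (gaussianReal 0 v).real {x | |x| ≤ t} := by
  rw [cdf_eq_real, absGaussian, map_measureReal_apply (by fun_prop) measurableSet_Iic]
  rfl

lemma continuous_cdf_absGaussian {v : NNReal} (hv : v ≠ 0) : Continuous (cdf (absGaussian v)) := by
  refine continuous_iff_continuousAt.2 fun x => ?_
  have := nullSingletonClass_gaussianReal (μ := 0) hv
  rw [(cdf (absGaussian v)).mono.continuousAt_iff_leftLim_eq_rightLim,
    StieltjesFunction.rightLim_eq]
  have h0 : (cdf (absGaussian v)).measure {x} = 0 := by
    rw [measure_cdf, absGaussian, Measure.map_apply (by fun_prop) (measurableSet_singleton x)]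
    refine measure_mono_null (t := {x, -x}) (fun y hy => ?_) (Set.Finite.measure_zero (by simp) _)
    have hy' : |y| = x := hy
    rcases abs_choice y with h | h
    · left; linarith
    · right; rw [Set.mem_singleton_iff]; linarith
  rw [StieltjesFunction.measure_singleton, ENNReal.ofReal_eq_zero] at h0
  linarith [(cdf (absGaussian v)).mono.leftLim_le (le_refl x)]

/-- There is a magnitude that the expected proportion `δ` of the weights does not exceed. -/
lemma exists_expected_proportion {v : Fin L → NNReal} (hv : ∀ l, v l ≠ 0) {δ : ℝ}
    (h0 : 0 < δ) (h1 : δ < 1) (hm : 0 < totalWeights M) :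
    ∃ t, ∑ l, M l * cdf (absGaussian (v l)) t = δ * totalWeights M := by
  have hmR : (0 : ℝ) < totalWeights M := by exact_mod_cast hm
  have hcont : Continuous fun t => ∑ l, (M l : ℝ) * cdf (absGaussian (v l)) t :=
    continuous_finsetSum _ fun l _ => continuous_const.mul (continuous_cdf_absGaussian (hv l))
  have hbot : Filter.Tendsto (fun t => ∑ l, (M l : ℝ) * cdf (absGaussian (v l)) t) Filter.atBot
      (nhds (∑ l, (M l : ℝ) * 0)) :=
    tendsto_finsetSum _ fun l _ => (tendsto_cdf_atBot _).const_mul _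
  have htop : Filter.Tendsto (fun t => ∑ l, (M l : ℝ) * cdf (absGaussian (v l)) t) Filter.atTop
      (nhds (∑ l, (M l : ℝ) * 1)) :=
    tendsto_finsetSum _ fun l _ => (tendsto_cdf_atTop _).const_mul _
  have htot : ∑ l, (M l : ℝ) * 1 = totalWeights M := by simp [totalWeights]
  -- The limits 0 and `totalWeights M` enclose the target; the intermediate value theorem applies.
  rw [htot] at htop
  simp only [mul_zero, Finset.sum_const_zero] at hbot
  obtain ⟨a, ha⟩ := (hbot.eventually_lt_const (mul_pos h0 hmR)).exists
  obtain ⟨b, hb⟩ := (htop.eventually_const_lt (mul_lt_of_lt_one_left hmR h1)).exists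
  exact mem_range_of_exists_le_of_exists_ge hcont ⟨a, ha.le⟩ ⟨b, hb.le⟩

/-! ### Expected critical sparsity -/

section Expectation

variable {Ω : Type*} [MeasurableSpace Ω] {P : Measure Ω} [IsProbabilityMeasure P]

lemma integrable_criticalSparsity {W : (l : Fin L) → Fin (M l) → Ω → ℝ}
    (hW : ∀ l i, AEMeasurable (W l i) P) :
    Integrable (fun ω => criticalSparsity fun l i => W l i ω) P := by
  refine Integrable.of_bound (C := 1) ?_ (Filter.Eventually.of_forall fun ω => ?_)
  · exact (measurable_criticalSparsity.comp_aemeasurable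
      (aemeasurable_pi_lambda (fun ω (j : WeightIndex M) => W j.1 j.2 ω)
        fun j => hW j.1 j.2)).aestronglyMeasurable
  · rw [Real.norm_of_nonneg (criticalSparsity_nonneg _)]
    exact criticalSparsity_le_one _

/-- The expected critical sparsity of measurable Gaussian weights is at most `δ`, up to an error
that decays exponentially in the depth. -/
lemma integral_criticalSparsity_le_of_measurable {V : WeightIndex M → Ω → ℝ}
    (hV : ∀ j, Measurable (V j)) (hind : iIndepFun V P) {v : Fin L → NNReal} (hv : ∀ l, v l ≠ 0)
    (hlaw : ∀ j, HasLaw (V j) (gaussianReal 0 (v j.1)) P) (hL : 0 < L) {K : ℕ}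
    (hM1 : ∀ l, 1 ≤ M l) (hMK : ∀ l, M l ≤ K + 1) {δ : ℝ} (h0 : 0 < δ) (h1 : δ < 1) :
    ∫ ω, criticalSparsity (fun l i => V ⟨l, i⟩ ω) ∂P ≤
      δ + Real.exp (-(L * (δ / (K + 1)) ^ (K + 1))) := by
  have hm : 0 < totalWeights M := totalWeights_pos_of_mem ⟨0, hL⟩ ⟨0, hM1 _⟩
  have hmR : (0 : ℝ) < totalWeights M := by exact_mod_cast hm
  obtain ⟨t, ht⟩ := exists_expected_proportion hv h0 h1 hm
  have hB : MeasurableSet {x : ℝ | |x| ≤ t} := measurableSet_le (by fun_prop) (by fun_prop)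
  have hp : ∀ j, P.real (V j ⁻¹' {x | |x| ≤ t}) = cdf (absGaussian (v j.1)) t := fun j => by
    rw [cdf_absGaussian]
    exact (hlaw j).measureReal_eq hB
  set E : Set Ω := ⋂ l, (⋂ i, V ⟨l, i⟩ ⁻¹' {x | |x| ≤ t})ᶜ with hE
  have hEm : MeasurableSet E := MeasurableSet.iInter fun l =>
    (MeasurableSet.iInter fun i => hV _ hB).compl
  have hPE : P.real E ≤ Real.exp (-(L * (δ / (K + 1)) ^ (K + 1))) := by
    rw [hE, measureReal_iInter_compl_layer hV hind hB]
    simp only [hp, Finset.prod_const, Finset.card_univ, Fintype.card_fin]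
    exact prod_one_sub_pow_le (fun l => cdf_nonneg _ _) (fun l => cdf_le_one _ _) hM1 hMK h0 ht
  have hind1 : ∀ j, Integrable ((V j ⁻¹' {x | |x| ≤ t}).indicator fun _ => (1 : ℝ)) P := fun j =>
    (integrable_const _).indicator (hV j hB)
  have hcount : Integrable (fun ω =>
      (∑ j, (V j ⁻¹' {x | |x| ≤ t}).indicator (fun _ => (1 : ℝ)) ω) / totalWeights M) P :=
    (integrable_finsetSum _ fun j _ => hind1 j).div_const _
  have hindE : Integrable (E.indicator fun _ => (1 : ℝ)) P := (integrable_const _).indicator hEm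
  calc ∫ ω, criticalSparsity (fun l i => V ⟨l, i⟩ ω) ∂P
      ≤ ∫ ω, ((∑ j, (V j ⁻¹' {x | |x| ≤ t}).indicator (fun _ => (1 : ℝ)) ω) / totalWeights M +
          E.indicator (fun _ => (1 : ℝ)) ω) ∂P := by
        refine integral_mono
          (integrable_criticalSparsity (W := fun l i => V ⟨l, i⟩) fun l i => (hV _).aemeasurable)
          (hcount.add hindE) fun ω => ?_
        have hnn : 0 ≤ (∑ j, (V j ⁻¹' {x | |x| ≤ t}).indicator (fun _ => (1 : ℝ)) ω) /
            totalWeights M :=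
          div_nonneg (Finset.sum_nonneg fun j _ => Set.indicator_nonneg (by simp) _) hmR.le
        -- On `E` no layer lies wholly below `t`, and only the trivial bound 1 is available.
        by_cases hω : ω ∈ E
        · simp only [Set.indicator_of_mem hω]
          linarith [criticalSparsity_le_one fun l i => V (⟨l, i⟩ : WeightIndex M) ω]
        · simp only [Set.indicator_of_notMem hω, add_zero]
          simp only [hE, Set.mem_iInter, Set.mem_compl_iff, not_forall, not_exists, not_not] at hω
          obtain ⟨l, hl⟩ := hω
          refine (criticalSparsity_le_of_layer_le (fun l i => V ⟨l, i⟩ ω) t l (hM1 l) hl).trans ?_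
          rw [Finset.card_filter]
          push_cast
          rfl
    _ = δ + P.real E := by
        rw [integral_add hcount hindE, integral_div, integral_finsetSum _ fun j _ => hind1 j,
          integral_indicator_const _ hEm]
        simp only [integral_indicator_const _ (hV _ hB), hp, smul_eq_mul, mul_one]
        rw [Fintype.sum_sigma]
        simp only [Finset.sum_const, Finset.card_univ, Fintype.card_fin, nsmul_eq_mul]
        rw [ht, mul_div_cancel_right₀ _ hmR.ne']
    _ ≤ _ := by linarith

/-- `HasLaw` gives only a.e. measurability, so the weights are replaced by measurable versions. -/
lemma integral_criticalSparsity_le {W : (l : Fin L) → Fin (M l) → Ω → ℝ}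
    (hind : iIndepFun (fun j : WeightIndex M => W j.1 j.2) P) {v : Fin L → NNReal}
    (hv : ∀ l, v l ≠ 0) (hlaw : ∀ l i, HasLaw (W l i) (gaussianReal 0 (v l)) P) (hL : 0 < L)
    {K : ℕ} (hM1 : ∀ l, 1 ≤ M l) (hMK : ∀ l, M l ≤ K + 1) {δ : ℝ} (h0 : 0 < δ) (h1 : δ < 1) :
    ∫ ω, criticalSparsity (fun l i => W l i ω) ∂P ≤
      δ + Real.exp (-(L * (δ / (K + 1)) ^ (K + 1))) := by
  set V : WeightIndex M → Ω → ℝ := fun j => (hlaw j.1 j.2).aemeasurable.mk (W j.1 j.2)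
  have hVW : ∀ j : WeightIndex M, W j.1 j.2 =ᵐ[P] V j := fun j =>
    (hlaw j.1 j.2).aemeasurable.ae_eq_mk
  have hae : (fun ω => criticalSparsity fun l i => W l i ω) =ᵐ[P]
      fun ω => criticalSparsity fun l i => V ⟨l, i⟩ ω := by
    filter_upwards [ae_all_iff.2 hVW] with ω hω
    congr 1
    funext l i
    exact hω ⟨l, i⟩
  rw [integral_congr_ae hae]
  exact integral_criticalSparsity_le_of_measurable
    (fun j => (hlaw j.1 j.2).aemeasurable.measurable_mk) (hind.congr hVW) hv
    (fun j => (hlaw j.1 j.2).congr (hVW j).symm) hL hM1 hMK h0 h1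

end Expectation

/-! ### Gaussian tails, quantiles and finiteness of `xPoint` -/

lemma hasSubgaussianMGF_id_gaussianReal :
    HasSubgaussianMGF (fun x : ℝ => x) 1 (gaussianReal 0 1) where
  integrable_exp_mul t := by simpa using integrable_exp_mul_gaussianReal (μ := 0) (v := 1) t
  mgf_le t := by simp [mgf_fun_id_gaussianReal]

lemma one_sub_cdf_absGaussian (t : ℝ) :
    1 - cdf (absGaussian 1) t = (gaussianReal 0 1).real {x | t < |x|} := by
  rw [cdf_absGaussian, ← probReal_compl_eq_one_sub (measurableSet_le (by fun_prop) (by fun_prop))]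
  congr 1
  ext x
  simp

lemma one_sub_cdf_absGaussian_le {t : ℝ} (ht : 0 ≤ t) :
    1 - cdf (absGaussian 1) t ≤ 2 * Real.exp (-t ^ 2 / 2) := by
  rw [one_sub_cdf_absGaussian]
  have h1 := hasSubgaussianMGF_id_gaussianReal.measure_ge_le ht
  have h2 := hasSubgaussianMGF_id_gaussianReal.neg.measure_ge_le ht
  have h3 : (gaussianReal 0 1).real {x | t < |x|} ≤
      (gaussianReal 0 1).real ({x | t ≤ x} ∪ {x | t ≤ (-fun x : ℝ => x) x}) := by
    refine measureReal_mono fun x hx => ?_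
    rcases lt_abs.1 (show t < |x| from hx) with h | h
    · exact Or.inl h.le
    · exact Or.inr h.le
  have h4 := measureReal_union_le (μ := gaussianReal 0 1) {x : ℝ | t ≤ x}
    {x : ℝ | t ≤ (-fun x : ℝ => x) x}
  simp only [NNReal.coe_one, mul_one] at h1 h2
  linarith

/-- On `(t, t + 1]` the density is at least its value at `t + 1`. -/
lemma le_one_sub_cdf_absGaussian {t : ℝ} (ht : 0 ≤ t) :
    (√(2 * Real.pi))⁻¹ * Real.exp (-(t + 1) ^ 2 / 2) ≤ 1 - cdf (absGaussian 1) t := by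
  rw [one_sub_cdf_absGaussian]
  have h1 : (gaussianReal 0 1).real (Set.Ioc t (t + 1)) ≤
      (gaussianReal 0 1).real {x | t < |x|} :=
    measureReal_mono fun x hx => hx.1.trans_le (le_abs_self x)
  refine le_trans ?_ h1
  have hnn : 0 ≤ ∫ x in Set.Ioc t (t + 1), gaussianPDFReal 0 1 x :=
    setIntegral_nonneg measurableSet_Ioc fun x _ => gaussianPDFReal_nonneg _ _ _
  rw [Measure.real, gaussianReal_apply_eq_integral _ one_ne_zero, ENNReal.toReal_ofReal hnn]
  calc (√(2 * Real.pi))⁻¹ * Real.exp (-(t + 1) ^ 2 / 2)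
      = ∫ _ in Set.Ioc t (t + 1), (√(2 * Real.pi))⁻¹ * Real.exp (-(t + 1) ^ 2 / 2) := by
        simp
    _ ≤ ∫ x in Set.Ioc t (t + 1), gaussianPDFReal 0 1 x := by
        refine setIntegral_mono_on (integrableOn_const (by simp)) (integrable_gaussianPDFReal _ _).integrableOn
          measurableSet_Ioc fun x hx => ?_
        simp only [gaussianPDFReal, NNReal.coe_one, mul_one, sub_zero]
        refine mul_le_mul_of_nonneg_left (Real.exp_le_exp.2 ?_) (by positivity)
        have h0 : 0 ≤ x := ht.trans hx.1.le
        have := hx.2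
        nlinarith

lemma one_sub_cdf_absGaussian_pos {t : ℝ} (ht : 0 ≤ t) : 0 < 1 - cdf (absGaussian 1) t :=
  lt_of_lt_of_le (by positivity) (le_one_sub_cdf_absGaussian ht)

/-- The tail of `|X|` at `√b * q` is eventually below the `a`-th power of the tail at `q`. -/
lemma exists_tail_le_tail_rpow {a b : ℝ} (ha : 0 < a) (hab : a < b) :
    ∃ q₀ : ℝ, 0 < q₀ ∧ ∀ q, q₀ ≤ q →
      1 - cdf (absGaussian 1) (√b * q) ≤ (1 - cdf (absGaussian 1) q) ^ a := by
  set c : ℝ := (√(2 * Real.pi))⁻¹ with hc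
  have hc0 : 0 < c := by positivity
  set C : ℝ := max 0 (Real.log 2 - a * Real.log c)
  have hC0 : 0 ≤ C := le_max_left _ _
  have hC : Real.log 2 - a * Real.log c ≤ C := le_max_right _ _
  have hD : 0 < b - a := sub_pos.2 hab
  -- For `q ≥ 1`, `2 * C + a * (2 * q + 1) ≤ (2 * C + 3 * a) * q`, which must not exceed `(b - a) *
  -- q ^ 2`.
  refine ⟨max 1 ((3 * a + 2 * C) / (b - a)), by positivity, fun q hq => ?_⟩
  have hq1 : 1 ≤ q := (le_max_left _ _).trans hq
  have hq2 : 3 * a + 2 * C ≤ q * (b - a) := (div_le_iff₀ hD).1 ((le_max_right _ _).trans hq)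
  have hq0 : 0 ≤ q := zero_le_one.trans hq1
  have key : Real.log 2 + -(√b * q) ^ 2 / 2 ≤ a * (Real.log c + -(q + 1) ^ 2 / 2) := by
    rw [mul_pow, Real.sq_sqrt (ha.trans hab).le]
    nlinarith [mul_le_mul_of_nonneg_left hq2 hq0, mul_nonneg hC0 (sub_nonneg.2 hq1),
      mul_nonneg ha.le (sub_nonneg.2 hq1)]
  calc 1 - cdf (absGaussian 1) (√b * q) ≤ 2 * Real.exp (-(√b * q) ^ 2 / 2) :=
        one_sub_cdf_absGaussian_le (by positivity)
    _ = Real.exp (Real.log 2 + -(√b * q) ^ 2 / 2) := by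
        rw [Real.exp_add, Real.exp_log two_pos]
    _ ≤ Real.exp (a * (Real.log c + -(q + 1) ^ 2 / 2)) := Real.exp_le_exp.2 key
    _ = (c * Real.exp (-(q + 1) ^ 2 / 2)) ^ a := by
        rw [mul_comm a, Real.exp_mul, Real.exp_add, Real.exp_log hc0]
    _ ≤ (1 - cdf (absGaussian 1) q) ^ a :=
        Real.rpow_le_rpow (by positivity) (le_one_sub_cdf_absGaussian hq0) ha.le

lemma cdf_absGaussian_of_neg {t : ℝ} (ht : t < 0) : cdf (absGaussian 1) t = 0 := by
  have : {x : ℝ | |x| ≤ t} = ∅ :=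
    Set.eq_empty_of_forall_notMem fun x hx => absurd (hx.trans_lt ht) (abs_nonneg x).not_gt
  rw [cdf_absGaussian, this, measureReal_empty]

lemma bddBelow_quantile {x : ℝ} (hx : 0 < x) : BddBelow {t : ℝ | x ≤ cdf (absGaussian 1) t} :=
  ⟨0, fun t ht => not_lt.1 fun h => by
    rw [Set.mem_ofPred_eq, cdf_absGaussian_of_neg h] at ht
    exact absurd ht hx.not_ge⟩

lemma le_cdf_quantile {x : ℝ} (h0 : 0 < x) (h1 : x < 1) :
    x ≤ cdf (absGaussian 1) (quantile x) := by
  have hclosed : IsClosed {t : ℝ | x ≤ cdf (absGaussian 1) t} :=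
    isClosed_le continuous_const (continuous_cdf_absGaussian one_ne_zero)
  obtain ⟨t, ht⟩ := ((tendsto_cdf_atTop (absGaussian 1)).eventually_const_lt h1).exists
  exact hclosed.csInf_mem ⟨t, ht.le⟩ (bddBelow_quantile h0)

/-- Scaling a high quantile of `|X|` by `γ` exceeds the quantile whose tail is the `a`-th power,
provided that `a < γ ^ 2`. -/
lemma exists_quantile_lt {a γ : ℝ} (ha : 0 < a) (hγ : 0 < γ) (haγ : a < γ ^ 2) :
    ∃ y ∈ Set.Ioo (0 : ℝ) 1, ∀ x ∈ Set.Ioo y 1,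
      quantile (1 - (1 - x) ^ a) < γ * quantile x := by
  -- The room between `√b` and `γ` makes the final inequality strict.
  obtain ⟨b, hab, hbγ⟩ := exists_between haγ
  obtain ⟨q₀, hq₀, hq⟩ := exists_tail_le_tail_rpow ha hab
  refine ⟨max (1 / 2) (cdf (absGaussian 1) q₀), ⟨by positivity, max_lt (by norm_num)
    (by linarith [one_sub_cdf_absGaussian_pos hq₀.le])⟩, fun x hx => ?_⟩
  have hx0 : 0 < x := lt_of_lt_of_le (by norm_num) ((le_max_left _ _).trans hx.1.le)
  have hxq : cdf (absGaussian 1) q₀ < x := (le_max_right _ _).trans_lt hx.1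
  have hF := le_cdf_quantile hx0 hx.2
  have hlt : q₀ < quantile x := (monotone_cdf _).reflect_lt (hxq.trans_le hF)
  have htail : 1 - cdf (absGaussian 1) (√b * quantile x) ≤ (1 - x) ^ a :=
    (hq _ hlt.le).trans (Real.rpow_le_rpow (by linarith [cdf_le_one (absGaussian 1) (quantile x)])
      (by linarith) ha.le)
  have hpos : 0 < 1 - (1 - x) ^ a :=
    sub_pos.2 (Real.rpow_lt_one (by linarith [hx.2]) (by linarith) ha)
  calc quantile (1 - (1 - x) ^ a) ≤ √b * quantile x :=
        csInf_le (bddBelow_quantile hpos) (show _ ≤ cdf (absGaussian 1) _ by linarith)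
    _ < γ * quantile x :=
        mul_lt_mul_of_pos_right ((Real.sqrt_lt' hγ).2 hbγ) (hq₀.trans hlt)

/-- The point `x_{ε,γ}` is the image of a real number in `[0, 1)`. -/
lemma exists_xPoint_eq {ε γ : ℝ} (hε : ε ∈ Set.Ioo (0 : ℝ) 2) (hγ : 1 < γ) :
    ∃ x : ℝ, 0 ≤ x ∧ x < 1 ∧ xPoint ε γ = x := by
  have ha : γ ^ (2 - ε) < γ ^ 2 := by
    rw [← Real.rpow_natCast γ 2]
    exact Real.rpow_lt_rpow_of_exponent_lt hγ (by push_cast; linarith [hε.1])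
  obtain ⟨y, hy, hyx⟩ :=
    exists_quantile_lt (Real.rpow_pos_of_pos (by linarith) (2 - ε)) (by linarith) ha
  have hle : xPoint ε γ ≤ y := sInf_le ⟨y, ⟨hy, hyx⟩, rfl⟩
  have hge : (0 : ℝ) ≤ xPoint ε γ := le_sInf (by
    rintro _ ⟨z, hz, rfl⟩
    exact EReal.coe_le_coe_iff.2 hz.1.1.le)
  have hT : xPoint ε γ ≠ ⊤ := (hle.trans_lt (EReal.coe_lt_top y)).ne
  have hB : xPoint ε γ ≠ ⊥ := ((EReal.bot_lt_coe 0).trans_le hge).ne'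
  have hco := EReal.coe_toReal hT hB
  rw [← hco] at hle hge
  exact ⟨_, EReal.coe_le_coe_iff.1 hge, (EReal.coe_le_coe_iff.1 hle).trans_lt hy.2, hco.symm⟩

lemma one_lt_gammaRatio {L : ℕ} (hL : 2 ≤ L) {α : Fin L → ℝ} {l₀ : Fin L} (hα : ∀ l, 0 < α l)
    (hmax : ∀ l, l ≠ l₀ → α l < α l₀) : 1 < gammaRatio α l₀ := by
  have : Nontrivial (Fin L) := Fin.nontrivial_iff_two_le.2 hL
  obtain ⟨l₁, hl₁⟩ := exists_ne l₀
  have : Nonempty {l : Fin L // l ≠ l₀} := ⟨⟨l₁, hl₁⟩⟩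
  obtain ⟨l, hl⟩ := exists_eq_ciInf_of_finite (f := fun l : {l : Fin L // l ≠ l₀} => α l₀ / α l)
  rw [gammaRatio, ← hl, one_lt_div (hα _)]
  exact hmax l l.2

/-! ### Lower bound for the main term and conclusion -/

/-- A lower bound for the main term that depends only on an upper bound for the exponent. -/
lemma half_rpow_div_le {a b m x : ℝ} (ha : 0 < a) (hab : a ≤ b) (hm : 1 ≤ m) (h0 : 0 ≤ x)
    (h1 : x < 1) :
    (1 / 2 : ℝ) ^ (1 + b) / (1 + b) ≤ x + m / (1 + a) * (1 - x) ^ (1 + a) := by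
  have hb : 0 < b := ha.trans_le hab
  -- For `x ≥ 1 / 2` the first summand suffices, otherwise the second.
  rcases le_or_gt (1 / 2) x with hx | hx
  · have h2 : (1 / 2 : ℝ) ^ (1 + b) ≤ (1 / 2 : ℝ) ^ (1 : ℝ) :=
      Real.rpow_le_rpow_of_exponent_ge (by norm_num) (by norm_num) (by linarith)
    rw [Real.rpow_one] at h2
    have h3 : (1 / 2 : ℝ) ^ (1 + b) / (1 + b) ≤ (1 / 2 : ℝ) ^ (1 + b) :=
      div_le_self (by positivity) (by linarith)
    have h4 : 0 ≤ m / (1 + a) * (1 - x) ^ (1 + a) :=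
      mul_nonneg (by positivity) (Real.rpow_nonneg (by linarith) _)
    linarith
  · have h2 : (1 / 2 : ℝ) ^ (1 + b) ≤ (1 - x) ^ (1 + a) :=
      (Real.rpow_le_rpow_of_exponent_ge (by norm_num) (by norm_num) (by linarith)).trans
        (Real.rpow_le_rpow (by norm_num) (by linarith) (by linarith))
    have h3 : 1 / (1 + b) ≤ m / (1 + a) := div_le_div₀ (by linarith) hm (by linarith) (by linarith)
    calc (1 / 2 : ℝ) ^ (1 + b) / (1 + b) = 1 / (1 + b) * (1 / 2 : ℝ) ^ (1 + b) := by ring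
      _ ≤ m / (1 + a) * (1 - x) ^ (1 + a) :=
        mul_le_mul h3 h2 (by positivity) (by positivity)
      _ ≤ _ := le_add_of_nonneg_left h0

lemma exp_neg_le_inv_sqrt {x : ℝ} (hx : 0 < x) : Real.exp (-x) ≤ 1 / √x := by
  rw [Real.exp_neg, ← one_div]
  refine one_div_le_one_div_of_le (Real.sqrt_pos.2 hx) ?_
  refine le_trans ?_ (Real.add_one_le_exp x)
  rw [Real.sqrt_le_left (by linarith)]
  nlinarith

end MagnitudePruning

theorem mainTheorem6 (N Z G : ℝ) (hN : 0 < N) :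
    ∃ ν : ℝ, 0 < ν ∧
      ∀ (L : ℕ) (M : Fin L → ℕ) (α ζ : Fin L → ℝ) (l₀ : Fin L) (σw : ℝ)
        (Ω : Type*) [MeasurableSpace Ω] (P : Measure Ω) [IsProbabilityMeasure P]
        (W : (l : Fin L) → Fin (M l) → Ω → ℝ),
        2 ≤ L → 0 < σw →
        (∀ l, 0 < α l) → (∀ l, 0 < ζ l) → (∀ l, (M l : ℝ) = ζ l * N ^ 2) →
        (∀ l, l ≠ l₀ → α l < α l₀) →
        (∀ l, ζ l ≤ Z) → MagnitudePruning.gammaRatio α l₀ ≤ G →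
        iIndepFun (fun j : MagnitudePruning.WeightIndex M => W j.1 j.2) P →
        (∀ l i, HasLaw (W l i) (gaussianReal 0 (Real.toNNReal (σw ^ 2 / (α l * N)))) P) →
        (∀ ε ∈ Set.Ioo (0 : ℝ) 2,
          MagnitudePruning.xPoint ε (MagnitudePruning.gammaRatio α l₀) ≠ ⊤ ∧
          MagnitudePruning.xPoint ε (MagnitudePruning.gammaRatio α l₀) ≠ ⊥) ∧
        Integrable (fun ω => MagnitudePruning.criticalSparsity fun l i => W l i ω) P ∧
        ∫ ω, MagnitudePruning.criticalSparsity (fun l i => W l i ω) ∂P ≤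
          (⨅ ε : Set.Ioo (0 : ℝ) 2,
            ((MagnitudePruning.xPoint ε (MagnitudePruning.gammaRatio α l₀)).toReal +
              ζ l₀ * N ^ 2 / (1 + MagnitudePruning.gammaRatio α l₀ ^ (2 - (ε : ℝ))) *
                (1 - (MagnitudePruning.xPoint ε (MagnitudePruning.gammaRatio α l₀)).toReal) ^
                  (1 + MagnitudePruning.gammaRatio α l₀ ^ (2 - (ε : ℝ))))) +
          ν / √(L * N ^ 2) := by
  obtain ⟨K, hK⟩ := exists_nat_ge (Z * N ^ 2)
  have hG : (0 : ℝ) < 1 + G ^ 2 := by positivity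
  -- The lower bound of `half_rpow_div_le` with `b = G ^ 2`, as `γ ^ (2 - ε) ≤ γ ^ 2 ≤ G ^ 2`.
  set δ : ℝ := (1 / 2 : ℝ) ^ (1 + G ^ 2) / (1 + G ^ 2) with hδ
  have hδ0 : 0 < δ := by positivity
  have hδ1 : δ < 1 := (div_lt_one hG).2
    ((Real.rpow_lt_one (by norm_num) (by norm_num) hG).trans_le (by linarith [sq_nonneg G]))
  set c : ℝ := (δ / (K + 1)) ^ (K + 1) with hc
  have hc0 : 0 < c := by positivity
  -- The factor `N` cancels `√(N ^ 2)`, turning `1 / √(L * c)` into the required form.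
  refine ⟨N / √c, by positivity, ?_⟩
  intro L M α ζ l₀ σw Ω _ P _ W hL hσ hα hζ hM hmax hZ hγG hind hlaw
  have hγ := MagnitudePruning.one_lt_gammaRatio hL hα hmax
  set γ := MagnitudePruning.gammaRatio α l₀
  have hM1 : ∀ l, 1 ≤ M l := fun l => by
    have h : (0 : ℝ) < M l := hM l ▸ mul_pos (hζ l) (by positivity)
    exact_mod_cast h
  have hMK : ∀ l, M l ≤ K + 1 := fun l => by
    have h : (M l : ℝ) ≤ K := by
      rw [hM l]
      exact (mul_le_mul_of_nonneg_right (hZ l) (by positivity)).trans hK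
    exact (Nat.cast_le.1 h).trans K.le_succ
  have hv : ∀ l, Real.toNNReal (σw ^ 2 / (α l * N)) ≠ 0 := fun l => by
    have := hα l
    exact (Real.toNNReal_pos.2 (by positivity)).ne'
  refine ⟨fun ε hε => ?_, MagnitudePruning.integrable_criticalSparsity
    fun l i => (hlaw l i).aemeasurable, ?_⟩
  · obtain ⟨x, -, -, hx⟩ := MagnitudePruning.exists_xPoint_eq hε hγ
    rw [hx]
    exact ⟨EReal.coe_ne_top x, EReal.coe_ne_bot x⟩
  have hLR : (0 : ℝ) < L := by exact_mod_cast (by omega : 0 < L)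
  have hE := MagnitudePruning.integral_criticalSparsity_le hind hv hlaw (by omega : 0 < L)
    hM1 hMK hδ0 hδ1
  have herr : Real.exp (-(L * c)) ≤ N / √c / √(L * N ^ 2) := by
    refine (MagnitudePruning.exp_neg_le_inv_sqrt (mul_pos hLR hc0)).trans_eq ?_
    rw [Real.sqrt_mul hLR.le, Real.sqrt_mul hLR.le, Real.sqrt_sq hN.le]
    field_simp
  refine hE.trans (add_le_add ?_ herr)
  have : Nonempty (Set.Ioo (0 : ℝ) 2) := ⟨⟨1, by norm_num⟩⟩
  refine le_ciInf fun ε => ?_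
  obtain ⟨x, hx0, hx1, hx⟩ := MagnitudePruning.exists_xPoint_eq ε.2 hγ
  rw [hx, EReal.toReal_coe, ← hM l₀]
  refine MagnitudePruning.half_rpow_div_le (Real.rpow_pos_of_pos (by linarith) _) ?_
    (by exact_mod_cast hM1 l₀) hx0 hx1
  calc γ ^ (2 - (ε : ℝ)) ≤ γ ^ (2 : ℝ) :=
        Real.rpow_le_rpow_of_exponent_le hγ.le (by linarith [ε.2.1])
    _ = γ ^ 2 := Real.rpow_two γ
    _ ≤ G ^ 2 := pow_le_pow_left₀ (by linarith) hγG 2
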